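/- Let $H$ be a separable real Hilbert space and let $m$ be a centered, nondegenerate Gaussian probability measure on $H$ with covariance operator $Q$ (nondegenerate: $\ker Q=\{0\}$). Let $\mathcal H:=Q^{1/2}H$ be the Cameron–Martin space, with scalar product $(x,y)_{\mathcal H}:=\langle Q^{-1/2}x,Q^{-1/2}y\rangle$ and norm $|x|_{\mathcal H}:=|Q^{-1/2}x|$. For a smooth cylindrical $u:H\to\mathbb R$, that is $u(x)=\varphi(\langle e_1,x\rangle,\dots,\langle e_n,x\rangle)$ with $e_i\in H$ and $\varphi\in C^\infty(\mathbb R^n)$, let $D_{\mathcal H}u(x)\in\mathcal H$ be the vector representing the functional $v\mapsto\frac{\partial u}{\partial v}(x)$ on $\mathcal H$ with respect to $(\cdot,\cdot)_{\mathcal H}$. For $1<p<\infty$, let $W^{1,p}_{\mathcal H}(H,m)$ be the completion of the smooth cylindrical functions $u$ of finite norm with respect to $\|u\|_{L^p(m)}+\||D_{\mathcal H}u|_{\mathcal H}\|_{L^p(m)}$; so $f\in W^{1,p}_{\mathcal H}(H,m)$ with $D_{\mathcal H}f=G$ means that $u_n\to f$ in $L^p(m)$ and $D_{\mathcal H}u_n\to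 G$ in $L^p(m;\mathcal H)$ for some such $u_n$. For $t>0$ and Borel $g:H\to\mathbb R$ put, wherever the integral exists, $$T_tg(x):=\int_H g\bigl(e^{-t}x+\sqrt{1-e^{-2t}}\,y\bigr)\,dm(y).$$ Let $p\in(1,\infty)$, $t>0$ and $f\in W^{1,p}_{\mathcal H}(H,m)$, and fix Borel versions of $f$ and of $|D_{\mathcal H}f|_{\mathcal H}$. Then for $m$-a.e. $x_0\in H$ the following holds for all $h\in\mathcal H$ (the exceptional null set does not depend on $h$): the integrals defining $T_tf$ and $T_t|D_{\mathcal H}f|_{\mathcal H}$ at $x_0$ and at $x_0+h$ converge absolutely, and $$|T_tf(x_0+h)-T_tf(x_0)|\le|h|_{\mathcal H}\,e^{|h|_{\mathcal H}^2/(4t)}\bigl(T_t|D_{\mathcal H}f|_{\mathcal H}(x_0+h)+T_t|D_{\mathcal H}f|_{\mathcal H}(x_0)\bigr).$$ -/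

import Mathlib

open MeasureTheory ProbabilityTheory Filter Topology
open scoped ENNReal ContDiff

set_option linter.unusedSectionVars false

noncomputable section

namespace WienerSpace

section SquareRoot

variable {H : Type*} [NormedAddCommGroup H] [InnerProductSpace ℝ H] [CompleteSpace H]

/-- The iteration `B₀ = 0`, `Bₙ₊₁ = (A + Bₙ²) / 2`, used to construct square roots. -/
def sqrtIter (A : H →L[ℝ] H) : ℕ → (H →L[ℝ] H)
  | 0 => 0
  | n + 1 => (2⁻¹ : ℝ) • (A + sqrtIter A n * sqrtIter A n)

/-- The scalar majorant of `sqrtIter`. -/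
def sqrtIterBound : ℕ → ℝ
  | 0 => 0
  | n + 1 => 2⁻¹ * (1 + sqrtIterBound n * sqrtIterBound n)

theorem sqrtIterBound_mem (n : ℕ) : 0 ≤ sqrtIterBound n ∧ sqrtIterBound n ≤ 1 := by
  induction n with
  | zero => simp [sqrtIterBound]
  | succ n ih =>
    simp only [sqrtIterBound]
    constructor <;> nlinarith [ih.1, ih.2]

theorem sqrtIterBound_mono : Monotone sqrtIterBound := by
  refine monotone_nat_of_le_succ fun n => ?_
  simp only [sqrtIterBound]
  nlinarith [sq_nonneg (1 - sqrtIterBound n)]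

theorem norm_sqrtIter_le {A : H →L[ℝ] H} (hA : ‖A‖ ≤ 1) (n : ℕ) :
    ‖sqrtIter A n‖ ≤ sqrtIterBound n := by
  induction n with
  | zero => simp [sqrtIter, sqrtIterBound]
  | succ n ih =>
    simp only [sqrtIter, sqrtIterBound]
    rw [norm_smul, Real.norm_of_nonneg (by norm_num)]
    refine mul_le_mul_of_nonneg_left ?_ (by norm_num)
    refine (norm_add_le _ _).trans (add_le_add hA ?_)
    exact (norm_mul_le _ _).trans (mul_le_mul ih ih (norm_nonneg _) (sqrtIterBound_mem n).1)

theorem norm_sqrtIter_succ_sub_le {A : H →L[ℝ] H} (hA : ‖A‖ ≤ 1) (n : ℕ) :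
    ‖sqrtIter A (n + 1) - sqrtIter A n‖ ≤ sqrtIterBound (n + 1) - sqrtIterBound n := by
  induction n with
  | zero => simpa [sqrtIter, sqrtIterBound] using norm_sqrtIter_le hA 1
  | succ n ih =>
    have e1 : sqrtIter A (n + 1 + 1) - sqrtIter A (n + 1) = (2⁻¹ : ℝ) •
        (sqrtIter A (n + 1) * (sqrtIter A (n + 1) - sqrtIter A n)
          + (sqrtIter A (n + 1) - sqrtIter A n) * sqrtIter A n) := by
      conv_lhs => rw [sqrtIter, show sqrtIter A (n + 1) = (2⁻¹ : ℝ) •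
        (A + sqrtIter A n * sqrtIter A n) from rfl, ← smul_sub]
      rw [← show sqrtIter A (n + 1) = (2⁻¹ : ℝ) • (A + sqrtIter A n * sqrtIter A n) from rfl]
      congr 1
      noncomm_ring
    have e2 : sqrtIterBound (n + 1 + 1) - sqrtIterBound (n + 1) = 2⁻¹ *
        (sqrtIterBound (n + 1) * (sqrtIterBound (n + 1) - sqrtIterBound n)
          + (sqrtIterBound (n + 1) - sqrtIterBound n) * sqrtIterBound n) := by
      rw [sqrtIterBound, show sqrtIterBound (n + 1) =
        2⁻¹ * (1 + sqrtIterBound n * sqrtIterBound n) from rfl]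
      ring
    have hd : 0 ≤ sqrtIterBound (n + 1) - sqrtIterBound n :=
      sub_nonneg.2 (sqrtIterBound_mono n.le_succ)
    rw [e1, e2, norm_smul, Real.norm_of_nonneg (by norm_num)]
    refine mul_le_mul_of_nonneg_left ((norm_add_le _ _).trans (add_le_add ?_ ?_)) (by norm_num)
    · exact (norm_mul_le _ _).trans (mul_le_mul (norm_sqrtIter_le hA _) ih (norm_nonneg _)
        (sqrtIterBound_mem _).1)
    · exact (norm_mul_le _ _).trans (mul_le_mul ih (norm_sqrtIter_le hA _) (norm_nonneg _) hd)

theorem exists_tendsto_sqrtIter {A : H →L[ℝ] H} (hA : ‖A‖ ≤ 1) :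
    ∃ B, Tendsto (sqrtIter A) atTop (𝓝 B) := by
  refine cauchySeq_tendsto_of_complete ?_
  refine cauchySeq_of_dist_le_of_summable
    (fun n => sqrtIterBound (n + 1) - sqrtIterBound n) (fun n => ?_) ?_
  · rw [dist_comm, dist_eq_norm]
    exact norm_sqrtIter_succ_sub_le hA n
  · refine summable_of_sum_range_le (c := 1)
      (fun n => sub_nonneg.2 (sqrtIterBound_mono n.le_succ)) fun n => ?_
    rw [Finset.sum_range_sub]
    have h0 : sqrtIterBound 0 = 0 := rfl
    linarith [(sqrtIterBound_mem n).2]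

theorem isSelfAdjoint_sqrtIter {A : H →L[ℝ] H} (hA : IsSelfAdjoint A) (n : ℕ) :
    IsSelfAdjoint (sqrtIter A n) := by
  induction n with
  | zero => exact IsSelfAdjoint.zero _
  | succ n ih =>
    refine IsSelfAdjoint.smul (IsSelfAdjoint.all _) (hA.add ?_)
    rw [← sq]
    exact ih.pow 2

/-- If `0 ≤ T` and `‖1 - T‖ ≤ 1`, then `T` has a positive square root. -/
theorem exists_sqrt_of_norm_le {T : H →L[ℝ] H} (hT : T.IsPositive) (h1 : ‖1 - T‖ ≤ 1) :
    ∃ S : H →L[ℝ] H, S.IsPositive ∧ S * S = T := by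
  obtain ⟨B, hB⟩ := exists_tendsto_sqrtIter h1
  have hBn : ‖B‖ ≤ 1 := le_of_tendsto hB.norm (Eventually.of_forall fun n =>
    (norm_sqrtIter_le h1 n).trans (sqrtIterBound_mem n).2)
  have hAsa : IsSelfAdjoint (1 - T) := (IsSelfAdjoint.one _).sub hT.isSelfAdjoint
  have hBsa : IsSelfAdjoint B := by
    have h2 : Tendsto (fun n => star (sqrtIter (1 - T) n)) atTop (𝓝 (star B)) := hB.star
    have h3 : (fun n => star (sqrtIter (1 - T) n)) = sqrtIter (1 - T) :=
      funext fun n => isSelfAdjoint_sqrtIter hAsa n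
    rw [h3] at h2
    exact tendsto_nhds_unique h2 hB
  have hfix : B = (2⁻¹ : ℝ) • ((1 - T) + B * B) := by
    refine tendsto_nhds_unique ((tendsto_add_atTop_iff_nat 1).2 hB) ?_
    exact ((hB.mul hB).const_add (1 - T)).const_smul (2⁻¹ : ℝ)
  have hfix2 : B + B = (1 - T) + B * B := by
    have h4 : (2 : ℝ) • B = (1 - T) + B * B := by
      conv_lhs => rw [hfix]
      rw [smul_smul]
      norm_num
    rwa [two_smul] at h4
  refine ⟨1 - B, ?_, ?_⟩
  · rw [ContinuousLinearMap.isPositive_iff']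
    refine ⟨(IsSelfAdjoint.one _).sub hBsa, fun x => ?_⟩
    have h5 : inner ℝ (B x) x ≤ ‖x‖ * ‖x‖ :=
      (real_inner_le_norm _ _).trans (mul_le_mul_of_nonneg_right
        ((B.le_opNorm x).trans (mul_le_of_le_one_left (norm_nonneg _) hBn)) (norm_nonneg _))
    have h6 : (1 - B) x = x - B x := rfl
    rw [h6, inner_sub_left, real_inner_self_eq_norm_mul_norm]
    linarith
  · calc (1 - B) * (1 - B) = 1 - (B + B) + B * B := by noncomm_ring
      _ = T := by rw [hfix2]; abel

theorem norm_sq_le_of_isPositive {T : H →L[ℝ] H} (hT : T.IsPositive) (x : H) :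
    ‖T x‖ ^ 2 ≤ ‖T‖ * inner ℝ (T x) x := by
  -- positivity of the quadratic form at `x - s • T x`, for every real `s`
  have hq : ∀ s : ℝ, 0 ≤ inner ℝ (T x) x - 2 * s * ‖T x‖ ^ 2 + s ^ 2 * (‖T‖ * ‖T x‖ ^ 2) := by
    intro s
    have h0 := hT.inner_nonneg_left (x - s • T x)
    have h1 : inner ℝ (T (T x)) x = ‖T x‖ ^ 2 := by
      rw [hT.inner_left_eq_inner_right, real_inner_self_eq_norm_sq]
    have h2 : inner ℝ (T (T x)) (T x) ≤ ‖T‖ * ‖T x‖ ^ 2 := by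
      refine (real_inner_le_norm _ _).trans ?_
      have := mul_le_mul_of_nonneg_right (T.le_opNorm (T x)) (norm_nonneg (T x))
      nlinarith
    simp only [map_sub, map_smul, inner_sub_left, inner_sub_right, inner_smul_left,
      inner_smul_right, real_inner_self_eq_norm_sq, h1, conj_trivial] at h0
    nlinarith [mul_le_mul_of_nonneg_left h2 (sq_nonneg s)]
  by_cases h : ‖T‖ = 0
  · have h0 : T = 0 := norm_eq_zero.1 h
    simp [h0]
  · have hpos : 0 < ‖T‖ := lt_of_le_of_ne (norm_nonneg _) (Ne.symm h)
    have h3 := hq ‖T‖⁻¹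
    have h4 : (‖T‖⁻¹) ^ 2 * (‖T‖ * ‖T x‖ ^ 2) = ‖T‖⁻¹ * ‖T x‖ ^ 2 := by
      field_simp
    rw [h4] at h3
    have h5 : ‖T‖⁻¹ * ‖T x‖ ^ 2 ≤ inner ℝ (T x) x := by linarith
    calc ‖T x‖ ^ 2 = ‖T‖ * (‖T‖⁻¹ * ‖T x‖ ^ 2) := by field_simp
      _ ≤ _ := mul_le_mul_of_nonneg_left h5 hpos.le

/-- Every bounded positive operator on a real Hilbert space has a positive square root. -/
theorem exists_sqrt {T : H →L[ℝ] H} (hT : T.IsPositive) :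
    ∃ S : H →L[ℝ] H, S.IsPositive ∧ S * S = T := by
  by_cases h : ‖T‖ = 0
  · exact ⟨0, ContinuousLinearMap.isPositive_zero, by simp [norm_eq_zero.1 h]⟩
  have hpos : 0 < ‖T‖ := lt_of_le_of_ne (norm_nonneg _) (Ne.symm h)
  have hc : (0 : ℝ) ≤ ‖T‖⁻¹ := inv_nonneg.2 hpos.le
  have hT' : (‖T‖⁻¹ • T).IsPositive := hT.smul_of_nonneg hc
  obtain ⟨S, hS, hSS⟩ := exists_sqrt_of_norm_le hT' (by
    refine ContinuousLinearMap.opNorm_le_bound _ zero_le_one fun x => ?_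
    rw [one_mul]
    have h1 : (1 - ‖T‖⁻¹ • T) x = x - ‖T‖⁻¹ • T x := rfl
    rw [h1]
    refine le_of_sq_le_sq ?_ (norm_nonneg _)
    rw [norm_sub_sq_real, norm_smul, inner_smul_right, Real.norm_of_nonneg hc,
      real_inner_comm, mul_pow]
    have h2 := norm_sq_le_of_isPositive hT x
    have h3 := hT.inner_nonneg_left x
    have h4 : ‖T‖⁻¹ ^ 2 * ‖T x‖ ^ 2 ≤ ‖T‖⁻¹ * inner ℝ (T x) x := by
      calc ‖T‖⁻¹ ^ 2 * ‖T x‖ ^ 2 ≤ ‖T‖⁻¹ ^ 2 * (‖T‖ * inner ℝ (T x) x) :=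
            mul_le_mul_of_nonneg_left h2 (sq_nonneg _)
        _ = _ := by field_simp
    nlinarith [mul_nonneg hc h3])
  refine ⟨Real.sqrt ‖T‖ • S, hS.smul_of_nonneg (Real.sqrt_nonneg _), ?_⟩
  rw [smul_mul_smul_comm, hSS, Real.mul_self_sqrt hpos.le, smul_smul, mul_inv_cancel₀ h, one_smul]

end SquareRoot

section CameronMartin

variable {H : Type*} [NormedAddCommGroup H] [InnerProductSpace ℝ H] [CompleteSpace H]
  [MeasurableSpace H] [BorelSpace H]

/-- The positive square root `Q^{1/2}` of the covariance operator `Q` of `m`. -/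
def sqrtCov (m : Measure H) : H →L[ℝ] H :=
  Classical.choose (exists_sqrt (T := covarianceOperator m) isPositive_covarianceOperator)

theorem isPositive_sqrtCov (m : Measure H) : (sqrtCov m).IsPositive :=
  (Classical.choose_spec
    (exists_sqrt (T := covarianceOperator m) isPositive_covarianceOperator)).1

theorem sqrtCov_mul_self (m : Measure H) : sqrtCov m * sqrtCov m = covarianceOperator m :=
  (Classical.choose_spec
    (exists_sqrt (T := covarianceOperator m) isPositive_covarianceOperator)).2

/-- The Cameron-Martin space `𝓗 = Q^{1/2} H`, as a vector space. It is a type of its own, so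
that it can carry the Cameron-Martin norm instead of the norm of `H`. -/
def CameronMartin (m : Measure H) : Type _ := LinearMap.range (sqrtCov m : H →ₗ[ℝ] H)

instance (m : Measure H) : AddCommGroup (CameronMartin m) :=
  inferInstanceAs (AddCommGroup (LinearMap.range (sqrtCov m : H →ₗ[ℝ] H)))

instance (m : Measure H) : Module ℝ (CameronMartin m) :=
  inferInstanceAs (Module ℝ (LinearMap.range (sqrtCov m : H →ₗ[ℝ] H)))

/-- The inclusion `𝓗 ⊆ H`, as a linear map. -/
def CameronMartin.val (m : Measure H) : CameronMartin m →ₗ[ℝ] H :=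
  (LinearMap.range (sqrtCov m : H →ₗ[ℝ] H)).subtype

/-- `Q^{1/2}` as a linear bijection from `(ker Q^{1/2})ᗮ` (which is all of `H` when `m` is
nondegenerate) onto `𝓗`. -/
def sqrtCovEquiv (m : Measure H) :
    (LinearMap.ker (sqrtCov m : H →ₗ[ℝ] H))ᗮ ≃ₗ[ℝ] CameronMartin m :=
  LinearEquiv.ofBijective
    ((sqrtCov m : H →ₗ[ℝ] H).rangeRestrict ∘ₗ
      (LinearMap.ker (sqrtCov m : H →ₗ[ℝ] H))ᗮ.subtype : _ →ₗ[ℝ]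
        LinearMap.range (sqrtCov m : H →ₗ[ℝ] H)) (by
    constructor
    · rw [← LinearMap.ker_eq_bot, LinearMap.ker_eq_bot']
      intro x hx
      have h1 : (x : H) ∈ LinearMap.ker (sqrtCov m : H →ₗ[ℝ] H) := by
        rw [LinearMap.mem_ker]
        exact congrArg Subtype.val hx
      exact Subtype.ext (inner_self_eq_zero.1 (x.2 _ h1))
    · rintro ⟨_, x, rfl⟩
      have : CompleteSpace (LinearMap.ker (sqrtCov m : H →ₗ[ℝ] H)) :=
        (sqrtCov m).isClosed_ker.completeSpace_coe
      obtain ⟨y, hy, z, hz, rfl⟩ :=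
        (LinearMap.ker (sqrtCov m : H →ₗ[ℝ] H)).exists_add_mem_mem_orthogonal x
      refine ⟨⟨z, hz⟩, Subtype.ext ?_⟩
      have hy' : (sqrtCov m : H →ₗ[ℝ] H) y = 0 := hy
      change (sqrtCov m : H →ₗ[ℝ] H) z = (sqrtCov m : H →ₗ[ℝ] H) (y + z)
      rw [map_add, hy', zero_add])

/-- `Q^{-1/2} : 𝓗 → H`. -/
def invSqrtCov (m : Measure H) : CameronMartin m →ₗ[ℝ] H :=
  (LinearMap.ker (sqrtCov m : H →ₗ[ℝ] H))ᗮ.subtype ∘ₗ (sqrtCovEquiv m).symm.toLinearMap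

theorem invSqrtCov_injective (m : Measure H) : Function.Injective (invSqrtCov m) :=
  Subtype.val_injective.comp (sqrtCovEquiv m).symm.injective

theorem sqrtCov_invSqrtCov (m : Measure H) (h : CameronMartin m) :
    sqrtCov m (invSqrtCov m h) = CameronMartin.val m h :=
  congrArg (CameronMartin.val m) ((sqrtCovEquiv m).apply_symm_apply h)

/-- The Cameron-Martin norm `|h|_𝓗 = |Q^{-1/2} h|`. -/
instance (m : Measure H) : NormedAddCommGroup (CameronMartin m) :=
  NormedAddCommGroup.induced (CameronMartin m) H (invSqrtCov m) (invSqrtCov_injective m)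

/-- The Cameron-Martin scalar product `(h, k)_𝓗 = ⟨Q^{-1/2} h, Q^{-1/2} k⟩`. -/
instance (m : Measure H) : InnerProductSpace ℝ (CameronMartin m) :=
  InnerProductSpace.induced (invSqrtCov m)

theorem CameronMartin.norm_def (m : Measure H) (h : CameronMartin m) : ‖h‖ = ‖invSqrtCov m h‖ :=
  rfl

theorem CameronMartin.inner_def (m : Measure H) (h k : CameronMartin m) :
    inner ℝ h k = inner ℝ (invSqrtCov m h) (invSqrtCov m k) :=
  rfl

instance (m : Measure H) : CompleteSpace (CameronMartin m) := by
  have e : CameronMartin m ≃ₗᵢ[ℝ] (LinearMap.ker (sqrtCov m : H →ₗ[ℝ] H))ᗮ :=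
    ⟨(sqrtCovEquiv m).symm, fun _ => rfl⟩
  exact (completeSpace_congr (e := e.toLinearEquiv.toEquiv)
    e.isometry.isUniformEmbedding).2 inferInstance

/-- The inclusion `𝓗 ⊆ H`, as a bounded operator. -/
def CameronMartin.incl (m : Measure H) : CameronMartin m →L[ℝ] H :=
  (CameronMartin.val m).mkContinuous ‖sqrtCov m‖ fun h => by
    rw [← sqrtCov_invSqrtCov, CameronMartin.norm_def]
    exact (sqrtCov m).le_opNorm _

/-- `D_𝓗 f(x) ∈ 𝓗`: the Riesz representative of the functional `𝓗 → ℝ`, `v ↦ ∂f/∂v (x)`. -/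
def cmGradient (m : Measure H) (f : H → ℝ) (x : H) : CameronMartin m :=
  (InnerProductSpace.toDual ℝ (CameronMartin m)).symm
    ((fderiv ℝ f x).comp (CameronMartin.incl m))

/-- Smooth cylindrical functions `x ↦ φ(⟨e₁, x⟩, …, ⟨eₙ, x⟩)` with `φ ∈ C^∞(ℝⁿ)`. -/
def IsSmoothCylindrical (f : H → ℝ) : Prop :=
  ∃ (n : ℕ) (e : Fin n → H) (φ : (Fin n → ℝ) → ℝ),
    ContDiff ℝ ∞ φ ∧ ∀ x, f x = φ fun i => inner ℝ (e i) x

/-- `f ∈ W^{1,p}_𝓗(H, m)` with `D_𝓗 f = G`: the pair `(f, G)` is the limit in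
`L^p(m) × L^p(m; 𝓗)` of pairs `(u, D_𝓗 u)` with `u` smooth cylindrical of finite Sobolev norm.
Thus `W^{1,p}_𝓗(H, m)`, the completion of the smooth cylindrical functions in the norm
`‖u‖_{L^p} + ‖|D_𝓗 u|_𝓗‖_{L^p}`, consists of the `f` for which there is such a `G`. -/
def HasSobolevGradient (m : Measure H) (p : ℝ≥0∞) (f : H → ℝ) (G : H → CameronMartin m) : Prop :=
  MemLp f p m ∧ MemLp G p m ∧
    ∃ u : ℕ → H → ℝ,
      (∀ n, IsSmoothCylindrical (u n) ∧ MemLp (u n) p m ∧ MemLp (cmGradient m (u n)) p m) ∧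
      Tendsto (fun n => eLpNorm (fun x => u n x - f x) p m) atTop (𝓝 0) ∧
      Tendsto (fun n => eLpNorm (fun x => cmGradient m (u n) x - G x) p m) atTop (𝓝 0)

/-- The argument `e^{-t} x + √(1 - e^{-2t}) y` in Mehler's formula. -/
def mehlerPoint (t : ℝ) (x y : H) : H :=
  Real.exp (-t) • x + Real.sqrt (1 - Real.exp (-2 * t)) • y

/-- Mehler's formula `T_t f(x) = ∫ f(e^{-t} x + √(1 - e^{-2t}) y) dm(y)`, at every point `x`. -/
def mehler (m : Measure H) (t : ℝ) (f : H → ℝ) (x : H) : ℝ :=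
  ∫ y, f (mehlerPoint t x y) ∂m

end CameronMartin

end WienerSpace

end

/-!
Write `S = Q^{1/2}`. For `h = S k` in the Cameron–Martin space, moving the base point of Mehler's
formula from `x` to `x + h` amounts to translating the integration variable by a multiple of `h`
(`mehlerPoint_add_incl`), and the Cameron–Martin theorem (`IsPaleyWiener.map_add_right`) says that
the translate of `m` by `S k` has density `exp (W - |k|² / 2)`, where `W` is the Paley–Wiener
functional of `k`. The inequality follows from two properties of these densities.

* They have moments of all orders, so translation along `𝓗` is bounded from `L^p(m)` to `L¹(m)` for
  `p > 1` (`exists_eLpNorm_add_right_le`). Hence everything at `x + h`, for all `h` at once, is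
  controlled by the section `y ↦ f (mehlerPoint t x y)` in `L^p(m)`. Mehler's map preserves measure,
  from `m ⊗ m` to `m`, so this section is in `L^p(m)` for almost every `x`, and a sequence converging
  fast enough in `L^p(m)` has convergent sections at almost every `x`. This is why the exceptional
  set does not depend on `h`, and it reduces the theorem to smooth functions.
* The densities `exp (r W - r² |k|² / 2)` of the translates by `r S k` are convex in `r` up to the
  factor `exp (|k|² / 2)`, so a mean over an intermediate translate is at most that factor times the
  sum of the means over the two ends (`lintegral_add_smul_le`). For a `C¹` function `u`, integrating
  `D_𝓗 u` along the segment from `x` to `x + h` then gives the inequality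
  (`lintegral_enorm_sub_mehlerPoint_le`); the constant comes from `1 / (e^{2t} - 1) ≤ 1 / (2t)`.

The Cameron–Martin theorem itself is proved by comparing characteristic functions. The functional
`W` is the `L²(m)`-limit of `⟨v_n, ·⟩` with `S v_n → k`, and the required exponential moment is
computed by splitting `⟨ξ, ·⟩` into a multiple of `W` and a part independent of `W`.
-/

namespace WienerSpace

section

variable {H : Type*} [NormedAddCommGroup H] [InnerProductSpace ℝ H] [CompleteSpace H]
  [SecondCountableTopology H] [MeasurableSpace H] [BorelSpace H]

/-! ### The Cameron–Martin theorem -/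

theorem inner_sqrtCov_left (m : Measure H) (x y : H) :
    inner ℝ (sqrtCov m x) y = inner ℝ x (sqrtCov m y) :=
  (isPositive_sqrtCov m).inner_left_eq_inner_right x y

theorem integral_inner_sq (m : Measure H) [IsGaussian m] (v : H) :
    ∫ x, inner ℝ v x ^ 2 ∂m = ‖sqrtCov m v‖ ^ 2 := by
  have h := covarianceOperator_inner (μ := m) (IsGaussian.memLp_two_id) v v
  rw [← sqrtCov_mul_self, mul_apply_eq_comp, inner_sqrtCov_left,
    real_inner_self_eq_norm_sq] at h
  simpa [sq] using h.symm

theorem charFun_eq_exp_sqrtCov (m : Measure H) [IsGaussian m] (hc : ∫ x, x ∂m = 0) (ξ : H) :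
    charFun m ξ = Complex.exp ((-(‖sqrtCov m ξ‖ ^ 2) / 2 : ℝ) : ℂ) := by
  have hc' : ∫ x, id x ∂m = 0 := hc
  rw [IsGaussian.charFun_eq', covarianceBilin_apply IsGaussian.memLp_two_id, hc',
    ← integral_inner_sq]
  simp only [sub_zero, inner_zero_right, ← sq]
  congr 1
  push_cast
  ring

/-- `W` is the Paley–Wiener functional of `k`: the Gaussian variable that equals `⟨v, ·⟩` when
`k = Q^{1/2} v` and is an `L²(m)`-limit of such variables in general. It is characterised by its
joint characteristic function with the bounded functionals `⟨ξ, ·⟩`. -/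
structure IsPaleyWiener (m : Measure H) (k : H) (W : H → ℝ) : Prop where
  measurable : Measurable W
  integral_cexp : ∀ (ξ : H) (b : ℝ),
    ∫ x, Complex.exp (((inner ℝ ξ x + b * W x : ℝ) : ℂ) * Complex.I) ∂m = Complex.exp ((-(‖sqrtCov m ξ + b • k‖ ^ 2) / 2 : ℝ) : ℂ)

theorem IsPaleyWiener.const_mul {m : Measure H} {k : H} {W : H → ℝ} (hW : IsPaleyWiener m k W)
    (r : ℝ) : IsPaleyWiener m (r • k) (fun x => r * W x) where
  measurable := hW.measurable.const_mul r
  integral_cexp ξ b := by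
    simp_rw [← mul_assoc, smul_smul]
    exact hW.integral_cexp ξ (b * r)

theorem isPaleyWiener_inner (m : Measure H) [IsGaussian m] (hc : ∫ x, x ∂m = 0) (v : H) :
    IsPaleyWiener m (sqrtCov m v) (fun x => inner ℝ v x) where
  measurable := by fun_prop
  integral_cexp ξ b := by
    rw [← map_smul, ← map_add, ← charFun_eq_exp_sqrtCov m hc, charFun_apply]
    simp [inner_add_right, inner_smul_right, real_inner_comm]

theorem memLp_inner (m : Measure H) [IsGaussian m] (v : H) :
    MemLp (fun x => inner ℝ v x) 2 m :=
  IsGaussian.memLp_dual m (innerSL ℝ v) 2 (by simp)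

theorem norm_toLp_inner (m : Measure H) [IsGaussian m] (v : H) :
    ‖(memLp_inner m v).toLp‖ = ‖sqrtCov m v‖ := by
  rw [← sq_eq_sq₀ (norm_nonneg _) (norm_nonneg _), ← integral_inner_sq,
    ← real_inner_self_eq_norm_sq, L2.inner_def]
  refine integral_congr_ae ?_
  filter_upwards [(memLp_inner m v).coeFn_toLp] with x hx
  rw [hx, real_inner_self_eq_norm_sq, Real.norm_eq_abs, sq_abs]

theorem dense_range_sqrtCov (m : Measure H)
    (hnondeg : ∀ v : H, covarianceOperator m v = 0 → v = 0) :
    DenseRange (sqrtCov m) := by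
  have h : (LinearMap.range (sqrtCov m : H →ₗ[ℝ] H))ᗮ = ⊥ := by
    refine (Submodule.eq_bot_iff _).2 fun v hv => hnondeg v ?_
    have h1 : sqrtCov m v = 0 := by
      refine ext_inner_left ℝ fun w => ?_
      rw [← inner_sqrtCov_left, inner_zero_right]
      exact hv _ ⟨w, rfl⟩
    rw [← sqrtCov_mul_self, mul_apply_eq_comp, h1, map_zero]
  have h2 := Submodule.topologicalClosure_eq_top_iff.2 h
  exact Submodule.dense_iff_topologicalClosure_eq_top.2 h2

/-- Nondegeneracy makes `Q^{1/2} H` dense, and `v ↦ ⟨v, ·⟩ ∈ L²(m)` is isometric for the seminorm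
`|Q^{1/2} v|`; the functional of `k` is the resulting `L²(m)`-limit. -/
theorem exists_isPaleyWiener (m : Measure H) [IsGaussian m] (hc : ∫ x, x ∂m = 0)
    (hnondeg : ∀ v : H, covarianceOperator m v = 0 → v = 0) (k : H) :
    ∃ W, IsPaleyWiener m k W := by
  obtain ⟨s, hs, hlim⟩ := mem_closure_iff_seq_limit.1 ((dense_range_sqrtCov m hnondeg).closure_eq ▸
    Set.mem_univ k : k ∈ closure (Set.range (sqrtCov m)))
  choose v hv using hs
  obtain rfl : (fun n => sqrtCov m (v n)) = s := funext hv
  have hcauchy : CauchySeq fun n => (memLp_inner m (v n)).toLp := by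
    have h1 := hlim.cauchySeq
    rw [Metric.cauchySeq_iff] at h1 ⊢
    intro ε hε
    obtain ⟨N, hN⟩ := h1 ε hε
    refine ⟨N, fun i hi j hj => ?_⟩
    have h2 := hN i hi j hj
    rw [dist_eq_norm] at h2 ⊢
    rw [← map_sub, ← norm_toLp_inner] at h2
    rw [← MemLp.toLp_sub]
    refine lt_of_eq_of_lt (congrArg norm ((MemLp.toLp_eq_toLp_iff _ _).2
      (ae_of_all _ fun x => ?_))) h2
    simp [inner_sub_left]
  obtain ⟨w, hw⟩ := cauchySeq_tendsto_of_complete hcauchy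
  obtain ⟨φ, hφ, hae⟩ := (tendstoInMeasure_of_tendsto_Lp hw).exists_seq_tendsto_ae
  obtain ⟨W, hWm, hWw⟩ := (Lp.aestronglyMeasurable w).aemeasurable
  refine ⟨W, hWm, fun ξ b => ?_⟩
  have hsub := hlim.comp hφ.tendsto_atTop
  refine tendsto_nhds_unique (f := fun n => ∫ x, Complex.exp
      (((inner ℝ ξ x + b * inner ℝ (v (φ n)) x : ℝ) : ℂ) * Complex.I) ∂m) (l := atTop) ?_ ?_
  · refine tendsto_integral_of_dominated_convergence (fun _ => 1) (fun n => ?_)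
      (integrable_const _) (fun n => ae_of_all _ fun x => ?_) ?_
    · exact (by fun_prop : Continuous _).aestronglyMeasurable
    · rw [Complex.norm_exp_ofReal_mul_I]
    · have hall : ∀ᵐ x ∂m, ∀ n,
          ((memLp_inner m (v (φ n))).toLp : H → ℝ) x = inner ℝ (v (φ n)) x :=
        ae_all_iff.2 fun n => (memLp_inner m (v (φ n))).coeFn_toLp
      filter_upwards [hae, hall, hWw] with x h1 h2 h3
      simp_rw [h2, h3] at h1
      exact ((Complex.continuous_exp.comp (by fun_prop : Continuous fun r : ℝ =>
        (((inner ℝ ξ x + b * r : ℝ) : ℂ) * Complex.I))).tendsto (W x)).comp h1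
  · simp_rw [fun n => (isPaleyWiener_inner m hc (v (φ n))).integral_cexp ξ b]
    exact ((by fun_prop : Continuous fun z : H =>
      Complex.exp ((-(‖sqrtCov m ξ + b • z‖ ^ 2) / 2 : ℝ) : ℂ)).tendsto k).comp hsub

theorem IsPaleyWiener.map_eq {m : Measure H} [IsProbabilityMeasure m] {k : H} {W : H → ℝ}
    (hW : IsPaleyWiener m k W) : m.map W = gaussianReal 0 (‖k‖₊ ^ 2) := by
  have := Measure.isProbabilityMeasure_map (μ := m) hW.measurable.aemeasurable
  refine Measure.ext_of_charFun (funext fun b => ?_)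
  rw [charFun_gaussianReal, charFun_apply_real,
    integral_map hW.measurable.aemeasurable (by fun_prop)]
  have h := hW.integral_cexp 0 b
  simp only [inner_zero_left, zero_add, map_zero, norm_smul, mul_pow, Real.norm_eq_abs,
    sq_abs] at h
  push_cast at h
  rw [h]
  congr 1
  push_cast
  ring

theorem IsPaleyWiener.integrable_exp_mul {m : Measure H} [IsProbabilityMeasure m] {k : H}
    {W : H → ℝ} (hW : IsPaleyWiener m k W) (q : ℝ) :
    Integrable (fun x => Real.exp (q * W x)) m := by
  have h := integrable_exp_mul_gaussianReal (μ := 0) (v := ‖k‖₊ ^ 2) q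
  rw [← hW.map_eq, integrable_map_measure (by fun_prop) hW.measurable.aemeasurable] at h
  exact h

/-- When `α` is chosen so that `Q^{1/2} ξ - α k` is orthogonal to `k`, the variable `⟨ξ, ·⟩ - α W`
is independent of `W`: the joint characteristic function factors. -/
theorem IsPaleyWiener.indepFun {m : Measure H} [IsProbabilityMeasure m] {k : H} {W : H → ℝ}
    (hW : IsPaleyWiener m k W) (ξ : H) (α : ℝ) (hα : inner ℝ (sqrtCov m ξ) k = α * ‖k‖ ^ 2) :
    IndepFun (fun x => inner ℝ ξ x - α * W x) W m := by
  have hWm := hW.measurable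
  rw [indepFun_iff_charFun_prod (by fun_prop) (by fun_prop)]
  intro t
  obtain ⟨a, b⟩ := t
  rw [charFun_apply, charFun_apply_real, charFun_apply_real,
    integral_map (by fun_prop) (by fun_prop), integral_map (by fun_prop) (by fun_prop),
    integral_map (by fun_prop) (by fun_prop)]
  -- the joint characteristic function at `(a, b)`, and the two marginal ones
  have h1 := hW.integral_cexp (a • ξ) (b - a * α)
  have h2 := hW.integral_cexp (a • ξ) (-(a * α))
  have h3 := hW.integral_cexp 0 b
  trans ∫ x, Complex.exp (((inner ℝ (a • ξ) x + (b - a * α) * W x : ℝ) : ℂ) * Complex.I) ∂m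
  · refine integral_congr_ae (ae_of_all _ fun x => ?_)
    simp only [WithLp.prod_inner_apply, inner_smul_left]
    congr 2
    simp
    ring
  trans (∫ x, Complex.exp (((inner ℝ (a • ξ) x + -(a * α) * W x : ℝ) : ℂ) * Complex.I) ∂m) *
    ∫ x, Complex.exp (((inner ℝ (0 : H) x + b * W x : ℝ) : ℂ) * Complex.I) ∂m
  · rw [h1, h2, h3, ← Complex.exp_add, ← Complex.ofReal_add]
    congr 2
    simp only [norm_add_sq_real, map_smul, map_zero, norm_smul, inner_smul_left, inner_smul_right,
      hα, mul_pow, Real.norm_eq_abs, sq_abs, conj_trivial, inner_zero_left, norm_zero]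
    ring
  · congr 1
    · refine integral_congr_ae (ae_of_all _ fun x => ?_)
      simp only [inner_smul_left]
      congr 2
      push_cast
      simp
      ring
    · refine integral_congr_ae (ae_of_all _ fun x => ?_)
      simp

/-- The exponential moment that identifies the density in the Cameron–Martin theorem. It is
obtained by splitting `⟨ξ, ·⟩` into a multiple of `W` and a part independent of `W`. -/
theorem IsPaleyWiener.integral_cexp_inner_add {m : Measure H} [IsProbabilityMeasure m] {k : H}
    {W : H → ℝ} (hW : IsPaleyWiener m k W) (ξ : H) :
    ∫ x, Complex.exp ((inner ℝ ξ x : ℂ) * Complex.I + (W x : ℂ)) ∂m =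
      Complex.exp ((-(‖sqrtCov m ξ‖ ^ 2) / 2 + ‖k‖ ^ 2 / 2 : ℝ) +
        (inner ℝ (sqrtCov m ξ) k : ℂ) * Complex.I) := by
  have hWm := hW.measurable
  -- if `k = 0`, both sides vanish and any `α` will do
  obtain ⟨α, hα⟩ : ∃ α, inner ℝ (sqrtCov m ξ) k = α * ‖k‖ ^ 2 := by
    by_cases hk : k = 0
    · exact ⟨0, by simp [hk]⟩
    · exact ⟨inner ℝ (sqrtCov m ξ) k / ‖k‖ ^ 2, by
        have := norm_ne_zero_iff.2 hk
        field_simp⟩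
  have hind := (hW.indepFun ξ α hα).comp (φ := fun r : ℝ => Complex.exp ((r : ℂ) * Complex.I))
    (ψ := fun r : ℝ => Complex.exp ((1 + α * Complex.I) * r)) (by fun_prop) (by fun_prop)
  have h1 := hind.integral_fun_mul_eq_mul_integral
    (Measurable.aestronglyMeasurable (by dsimp only [Function.comp_def]; fun_prop))
    (Measurable.aestronglyMeasurable (by dsimp only [Function.comp_def]; fun_prop))
  have h2 := complexMGF_gaussianReal hW.map_eq (1 + α * Complex.I)
  rw [complexMGF] at h2
  simp only [Function.comp_def] at h1
  have h3 := hW.integral_cexp ξ (-α)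
  simp only [neg_mul, ← sub_eq_add_neg] at h3
  rw [h2, h3, ← Complex.exp_add] at h1
  convert h1 using 1
  · refine integral_congr_ae (ae_of_all _ fun x => ?_)
    dsimp only
    rw [← Complex.exp_add]
    congr 1
    push_cast
    ring
  · congr 1
    have e : ‖sqrtCov m ξ + -α • k‖ ^ 2 = ‖sqrtCov m ξ‖ ^ 2 - α ^ 2 * ‖k‖ ^ 2 := by
      rw [norm_add_sq_real, inner_smul_right, hα, norm_smul, mul_pow, Real.norm_eq_abs, sq_abs]
      ring
    rw [e, hα]
    push_cast
    linear_combination (- (α : ℂ) ^ 2 * (‖k‖ : ℂ) ^ 2 / 2) * Complex.I_sq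

/-- **Cameron–Martin theorem**: the translate of `m` by `Q^{1/2} k` has density
`exp (W - |k|² / 2)` with respect to `m`. -/
theorem IsPaleyWiener.map_add_right {m : Measure H} [IsGaussian m] (hc : ∫ x, x ∂m = 0) {k : H}
    {W : H → ℝ} (hW : IsPaleyWiener m k W) :
    m.map (fun x => x + sqrtCov m k) =
      m.withDensity fun x => ENNReal.ofReal (Real.exp (W x - ‖k‖ ^ 2 / 2)) := by
  have hWm := hW.measurable
  have hint : Integrable (fun x => Real.exp (W x - ‖k‖ ^ 2 / 2)) m := by
    have := (hW.integrable_exp_mul 1).div_const (Real.exp (‖k‖ ^ 2 / 2))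
    simpa [Real.exp_sub] using this
  have : IsFiniteMeasure (m.withDensity fun x => ENNReal.ofReal (Real.exp (W x - ‖k‖ ^ 2 / 2))) :=
    isFiniteMeasure_withDensity_ofReal hint.hasFiniteIntegral
  refine Measure.ext_of_charFun (funext fun ξ => ?_)
  rw [charFun_map_add_const, charFun_eq_exp_sqrtCov m hc, charFun_apply,
    integral_withDensity_eq_integral_toReal_smul (by fun_prop) (by simp)]
  have h := congrArg (fun z => z * Complex.exp ((-(‖k‖ ^ 2 / 2) : ℝ) : ℂ))
    (hW.integral_cexp_inner_add ξ)
  beta_reduce at h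
  rw [← integral_mul_const, ← Complex.exp_add] at h
  rw [← Complex.exp_add]
  refine Eq.trans ?_ (h.symm.trans ?_)
  · congr 1
    rw [inner_sqrtCov_left m k, real_inner_comm]
    push_cast
    ring
  · refine integral_congr_ae (ae_of_all _ fun x => ?_)
    simp only [ENNReal.toReal_ofReal (Real.exp_nonneg _), Complex.real_smul, Complex.ofReal_exp]
    rw [← Complex.exp_add, ← Complex.exp_add, real_inner_comm]
    congr 1
    push_cast
    ring

/-! ### Estimates for translations along the Cameron–Martin space -/

theorem IsPaleyWiener.lintegral_add_right {m : Measure H} [IsGaussian m] (hc : ∫ x, x ∂m = 0)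
    {k : H} {W : H → ℝ} (hW : IsPaleyWiener m k W) {F : H → ℝ≥0∞} (hF : Measurable F) :
    ∫⁻ y, F (y + sqrtCov m k) ∂m =
      ∫⁻ y, ENNReal.ofReal (Real.exp (W y - ‖k‖ ^ 2 / 2)) * F y ∂m := by
  have hWm := hW.measurable
  rw [← lintegral_map (f := F) hF (by fun_prop), hW.map_add_right hc,
    lintegral_withDensity_eq_lintegral_mul _ (by fun_prop) hF]
  rfl

theorem IsPaleyWiener.memLp_density {m : Measure H} [IsProbabilityMeasure m] {k : H} {W : H → ℝ}
    (hW : IsPaleyWiener m k W) {q : ℝ≥0∞} (hq0 : q ≠ 0) (hq : q ≠ ⊤) :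
    MemLp (fun y => Real.exp (W y - ‖k‖ ^ 2 / 2)) q m := by
  have hWm := hW.measurable
  rw [← integrable_norm_rpow_iff (by fun_prop) hq0 hq]
  have h := (hW.integrable_exp_mul q.toReal).mul_const (Real.exp (-(q.toReal * (‖k‖ ^ 2 / 2))))
  refine h.congr (ae_of_all _ fun y => ?_)
  beta_reduce
  rw [Real.norm_of_nonneg (Real.exp_nonneg _), ← Real.exp_mul, ← Real.exp_add]
  congr 1
  ring

/-- Translation along the Cameron–Martin space is bounded from `L^p(m)` to `L¹(m)` for every
`p > 1`, because the density of the translated measure has finite moments of all orders. -/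
theorem exists_eLpNorm_add_right_le (m : Measure H) [IsGaussian m] (hc : ∫ x, x ∂m = 0)
    (hnondeg : ∀ v : H, covarianceOperator m v = 0 → v = 0) {p : ℝ≥0∞} (hp : 1 < p) (k : H) :
    ∃ C : ℝ≥0∞, C ≠ ⊤ ∧ ∀ F : H → ℝ, Measurable F →
      eLpNorm (fun y => F (y + sqrtCov m k)) 1 m ≤ C * eLpNorm F p m := by
  obtain ⟨W, hW⟩ := exists_isPaleyWiener m hc hnondeg k
  have hWm := hW.measurable
  have hconj : ENNReal.HolderConjugate p (ENNReal.conjExponent p) :=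
    ENNReal.HolderConjugate.conjExponent hp.le
  have : ENNReal.HolderConjugate (ENNReal.conjExponent p) p := hconj.symm
  have hq : ENNReal.conjExponent p ≠ ⊤ :=
    ((ENNReal.HolderConjugate.lt_top_iff_one_lt _ p).2 hp).ne
  refine ⟨eLpNorm (fun y => Real.exp (W y - ‖k‖ ^ 2 / 2)) (ENNReal.conjExponent p) m,
    (hW.memLp_density (ENNReal.HolderConjugate.ne_zero _ p) hq).eLpNorm_ne_top,
    fun F hF => ?_⟩
  refine le_trans (le_of_eq ?_) (eLpNorm_smul_le_mul_eLpNorm (r := 1)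
    hF.aestronglyMeasurable (by fun_prop))
  rw [eLpNorm_one_eq_lintegral_enorm, eLpNorm_one_eq_lintegral_enorm,
    hW.lintegral_add_right hc (F := fun y => ‖F y‖ₑ) (by fun_prop)]
  refine lintegral_congr fun y => ?_
  simp [enorm_mul, Real.enorm_of_nonneg (Real.exp_nonneg _)]

/-- By convexity, `exp (r a) ≤ r exp a + (1 - r)` with `a = w - s / 2`; the remaining exponent is
`r (1 - r) s / 2 ≤ s / 2`. -/
theorem exp_mul_sub_le {r s w : ℝ} (hr0 : 0 ≤ r) (hr1 : r ≤ 1) (hs : 0 ≤ s) :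
    Real.exp (r * w - r ^ 2 * s / 2) ≤ Real.exp (s / 2) * (Real.exp (w - s / 2) + 1) := by
  have hconv := convexOn_exp.2 (Set.mem_univ (w - s / 2)) (Set.mem_univ 0) hr0
    (sub_nonneg.2 hr1) (by ring)
  simp only [smul_eq_mul, mul_zero, add_zero, Real.exp_zero, mul_one] at hconv
  have h1 : Real.exp (r * (w - s / 2)) ≤ Real.exp (w - s / 2) + 1 := by
    nlinarith [Real.exp_nonneg (w - s / 2)]
  calc Real.exp (r * w - r ^ 2 * s / 2)
      = Real.exp (r * (1 - r) * (s / 2)) * Real.exp (r * (w - s / 2)) := by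
        rw [← Real.exp_add]
        congr 1
        ring
    _ ≤ _ := by
        refine mul_le_mul (Real.exp_le_exp.2 ?_) h1 (Real.exp_nonneg _) (Real.exp_nonneg _)
        nlinarith [mul_nonneg hr0 hs, mul_nonneg (mul_nonneg hr0 hr0) hs]

/-- The mean of `F` over an intermediate translate is controlled by the means over the two end
translates: the densities `exp (r W - r² |k|² / 2)` are convex in `r` up to a Gaussian factor. -/
theorem lintegral_add_smul_le (m : Measure H) [IsGaussian m] (hc : ∫ x, x ∂m = 0)
    (hnondeg : ∀ v : H, covarianceOperator m v = 0 → v = 0) (k : H) {r : ℝ} (hr0 : 0 ≤ r)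
    (hr1 : r ≤ 1) {F : H → ℝ≥0∞} (hF : Measurable F) :
    ∫⁻ y, F (y + r • sqrtCov m k) ∂m ≤ ENNReal.ofReal (Real.exp (‖k‖ ^ 2 / 2)) *
      (∫⁻ y, F (y + sqrtCov m k) ∂m + ∫⁻ y, F y ∂m) := by
  obtain ⟨W, hW⟩ := exists_isPaleyWiener m hc hnondeg k
  have hWm := hW.measurable
  rw [← map_smul, (hW.const_mul r).lintegral_add_right hc hF, hW.lintegral_add_right hc hF,
    ← lintegral_add_right _ hF, ← lintegral_const_mul _ (by fun_prop)]
  refine lintegral_mono fun y => ?_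
  rw [show ENNReal.ofReal (Real.exp (W y - ‖k‖ ^ 2 / 2)) * F y + F y =
      (ENNReal.ofReal (Real.exp (W y - ‖k‖ ^ 2 / 2)) + 1) * F y by ring, ← mul_assoc,
    ← ENNReal.ofReal_one, ← ENNReal.ofReal_add (Real.exp_nonneg _) zero_le_one,
    ← ENNReal.ofReal_mul (Real.exp_nonneg _)]
  gcongr
  rw [norm_smul, mul_pow, Real.norm_eq_abs, sq_abs]
  exact exp_mul_sub_le hr0 hr1 (sq_nonneg _)

/-! ### Mehler's map -/

theorem continuous_mehlerPoint (t : ℝ) : Continuous fun z : H × H => mehlerPoint t z.1 z.2 := by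
  unfold mehlerPoint
  fun_prop

theorem measurable_mehlerPoint_right (t : ℝ) (x : H) : Measurable (mehlerPoint t x) :=
  ((continuous_mehlerPoint t).comp (by fun_prop : Continuous fun y : H => (x, y))).measurable

/-- Mehler's map is the first component of a rotation of `H × H`, which preserves `m ⊗ m`. -/
theorem measurePreserving_mehlerPoint (m : Measure H) [IsGaussian m] (hc : ∫ x, x ∂m = 0)
    {t : ℝ} (ht : 0 ≤ t) :
    MeasurePreserving (fun z : H × H => mehlerPoint t z.1 z.2) (m.prod m) m := by
  have h1 : MeasurePreserving (ContinuousLinearMap.rotation (Real.arccos (Real.exp (-t))))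
      (m.prod m) (m.prod m) :=
    ⟨by fun_prop, IsGaussian.map_rotation_eq_self hc _⟩
  have h2 := (measurePreserving_fst (μ := m) (ν := m)).comp h1
  convert h2 using 1
  ext z
  have hexp : Real.exp (-t) ≤ 1 := Real.exp_le_one_iff.2 (by linarith)
  simp only [mehlerPoint, ContinuousLinearMap.rotation, Function.comp_apply,
    ContinuousLinearMap.coe_mk', LinearMap.coe_mk, AddHom.coe_mk]
  rw [Real.cos_arccos (by linarith [Real.exp_nonneg (-t)]) hexp, Real.sin_arccos,
    ← Real.exp_nat_mul]
  congr 4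
  push_cast
  ring_nf

theorem lintegral_eLpNorm_mehlerPoint (m : Measure H) [IsGaussian m] (hc : ∫ x, x ∂m = 0)
    {t : ℝ} (ht : 0 ≤ t) {p : ℝ≥0∞} (hp0 : p ≠ 0) (hp : p ≠ ⊤) {F : H → ℝ} (hF : Measurable F) :
    ∫⁻ x, eLpNorm (fun y => F (mehlerPoint t x y)) p m ^ p.toReal ∂m =
      eLpNorm F p m ^ p.toReal := by
  have hpos : 0 < p.toReal := ENNReal.toReal_pos hp0 hp
  have e : ∀ G : H → ℝ, eLpNorm G p m ^ p.toReal = ∫⁻ y, ‖G y‖ₑ ^ p.toReal ∂m := fun G => by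
    rw [eLpNorm_eq_lintegral_rpow_enorm_toReal hp0 hp, ← ENNReal.rpow_mul,
      one_div_mul_cancel hpos.ne', ENNReal.rpow_one]
  have hmp := measurePreserving_mehlerPoint m hc ht
  simp_rw [e]
  rw [← hmp.lintegral_comp (f := fun y => ‖F y‖ₑ ^ p.toReal) (by fun_prop),
    lintegral_prod (fun z : H × H => ‖F (mehlerPoint t z.1 z.2)‖ₑ ^ p.toReal)
      (AEMeasurable.pow_const (hF.comp hmp.measurable).enorm.aemeasurable _)]

theorem measurable_eLpNorm_mehlerPoint (m : Measure H) [IsGaussian m] (t : ℝ) {p : ℝ≥0∞}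
    (hp0 : p ≠ 0) (hp : p ≠ ⊤) {F : H → ℝ} (hF : Measurable F) :
    Measurable fun x => eLpNorm (fun y => F (mehlerPoint t x y)) p m ^ p.toReal := by
  simp_rw [eLpNorm_eq_lintegral_rpow_enorm_toReal hp0 hp]
  refine Measurable.pow_const (Measurable.pow_const ?_ _) _
  exact Measurable.lintegral_prod_right'
    (f := fun z : H × H => ‖F (mehlerPoint t z.1 z.2)‖ₑ ^ p.toReal)
    (Measurable.pow_const (hF.comp (continuous_mehlerPoint t).measurable).enorm _)

theorem ae_memLp_mehlerPoint (m : Measure H) [IsGaussian m] (hc : ∫ x, x ∂m = 0)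
    {t : ℝ} (ht : 0 ≤ t) {p : ℝ≥0∞} (hp0 : p ≠ 0) (hp : p ≠ ⊤) {F : H → ℝ} (hF : Measurable F)
    (hFp : MemLp F p m) : ∀ᵐ x ∂m, MemLp (fun y => F (mehlerPoint t x y)) p m := by
  have hpos : 0 < p.toReal := ENNReal.toReal_pos hp0 hp
  have h := lintegral_eLpNorm_mehlerPoint m hc ht hp0 hp hF
  filter_upwards [ae_lt_top (measurable_eLpNorm_mehlerPoint m t hp0 hp hF)
    (h ▸ ENNReal.rpow_ne_top_of_nonneg hpos.le hFp.eLpNorm_ne_top)] with x hx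
  exact ⟨(hF.comp (measurable_mehlerPoint_right t x)).aestronglyMeasurable,
    (ENNReal.rpow_lt_top_iff_of_pos hpos).1 hx⟩

/-- If the `p`-th powers of the `L^p(m)`-norms of `F n` are summable, then for almost every `x` so are
those of the sections of `F n` at `x`, and in particular these sections tend to zero. -/
theorem ae_tendsto_eLpNorm_mehlerPoint (m : Measure H) [IsGaussian m] (hc : ∫ x, x ∂m = 0)
    {t : ℝ} (ht : 0 ≤ t) {p : ℝ≥0∞} (hp0 : p ≠ 0) (hp : p ≠ ⊤) {F : ℕ → H → ℝ}
    (hF : ∀ n, Measurable (F n)) (hsum : ∑' n, eLpNorm (F n) p m ^ p.toReal ≠ ⊤) :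
    ∀ᵐ x ∂m, Tendsto (fun n => eLpNorm (fun y => F n (mehlerPoint t x y)) p m) atTop (𝓝 0) := by
  have hpos : 0 < p.toReal := ENNReal.toReal_pos hp0 hp
  have hmeas := fun n => measurable_eLpNorm_mehlerPoint m t hp0 hp (hF n)
  have h : ∫⁻ x, ∑' n, eLpNorm (fun y => F n (mehlerPoint t x y)) p m ^ p.toReal ∂m ≠ ⊤ := by
    rw [lintegral_tsum fun n => (hmeas n).aemeasurable]
    simpa only [lintegral_eLpNorm_mehlerPoint m hc ht hp0 hp (hF _)] using hsum
  filter_upwards [ae_lt_top (Measurable.tsum hmeas) h] with x hx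
  have h1 := (ENNReal.tendsto_atTop_zero_of_tsum_ne_top hx.ne).ennrpow_const (p.toReal)⁻¹
  simpa only [ENNReal.rpow_rpow_inv hpos.ne', ENNReal.zero_rpow_of_pos (inv_pos.2 hpos)] using h1

theorem exists_strictMono_tsum_ne_top {a : ℕ → ℝ≥0∞} (ha : Tendsto a atTop (𝓝 0)) :
    ∃ φ : ℕ → ℕ, StrictMono φ ∧ ∑' n, a (φ n) ≠ ⊤ := by
  obtain ⟨φ, hφ, h⟩ := extraction_forall_of_eventually' (P := fun n k => a k ≤ 2⁻¹ ^ n)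
    fun n => (eventually_atTop.1 (ha.eventually_le_const
      (ENNReal.pow_pos (by simp) n)))
  refine ⟨φ, hφ, ne_top_of_le_ne_top ?_ (ENNReal.tsum_le_tsum h)⟩
  rw [ENNReal.tsum_geometric]
  simp

/-- Moving the base point of Mehler's formula along `𝓗` amounts to translating the integration
variable along `𝓗`. -/
theorem mehlerPoint_add_incl (m : Measure H) {t : ℝ} (ht : 0 < t) (x y : H) (h : CameronMartin m) :
    mehlerPoint t (x + CameronMartin.incl m h) y = mehlerPoint t x
      (y + sqrtCov m ((Real.exp (-t) / √(1 - Real.exp (-2 * t))) • invSqrtCov m h)) := by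
  have hs : √(1 - Real.exp (-2 * t)) ≠ 0 :=
    (Real.sqrt_pos.2 (sub_pos.2 (Real.exp_lt_one_iff.2 (by linarith)))).ne'
  have h1 : CameronMartin.incl m h = sqrtCov m (invSqrtCov m h) := (sqrtCov_invSqrtCov m h).symm
  rw [mehlerPoint, mehlerPoint, h1, map_smul, smul_add, smul_add, smul_smul,
    mul_div_cancel₀ _ hs]
  abel

/-- The squared factor is `e^{-2t} / (1 - e^{-2t}) = 1 / (e^{2t} - 1) ≤ 1 / (2t)`. -/
theorem norm_sq_smul_invSqrtCov_le (m : Measure H) {t : ℝ} (ht : 0 < t) (h : CameronMartin m) :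
    ‖(Real.exp (-t) / √(1 - Real.exp (-2 * t))) • invSqrtCov m h‖ ^ 2 / 2 ≤ ‖h‖ ^ 2 / (4 * t) := by
  have hpos : 0 < 1 - Real.exp (-2 * t) := sub_pos.2 (Real.exp_lt_one_iff.2 (by linarith))
  have e1 : Real.exp (-t) ^ 2 = Real.exp (-2 * t) := by
    rw [← Real.exp_nat_mul]
    congr 1
    push_cast
    ring
  have h1 : Real.exp (-2 * t) / (1 - Real.exp (-2 * t)) ≤ 1 / (2 * t) := by
    rw [div_le_div_iff₀ hpos (by linarith)]
    have h2 := Real.add_one_le_exp (2 * t)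
    have h3 : Real.exp (-2 * t) * Real.exp (2 * t) = 1 := by
      rw [← Real.exp_add]
      simp
    nlinarith [Real.exp_pos (-2 * t)]
  rw [norm_smul, mul_pow, Real.norm_eq_abs, sq_abs, div_pow, Real.sq_sqrt hpos.le, e1,
    ← CameronMartin.norm_def]
  calc _ ≤ 1 / (2 * t) * ‖h‖ ^ 2 / 2 := by gcongr
    _ = _ := by field_simp; ring

/-! ### The inequality for smooth functions -/

theorem IsSmoothCylindrical.contDiff {u : H → ℝ} (hu : IsSmoothCylindrical u) :
    ContDiff ℝ 1 u := by
  obtain ⟨n, e, φ, hφ, h⟩ := hu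
  rw [funext h]
  exact (hφ.of_le (by exact_mod_cast le_top)).comp (contDiff_pi.2 fun i => (innerSL ℝ (e i)).contDiff)

theorem inner_cmGradient (m : Measure H) (u : H → ℝ) (x : H) (h : CameronMartin m) :
    inner ℝ (cmGradient m u x) h = fderiv ℝ u x (CameronMartin.incl m h) := by
  rw [cmGradient, InnerProductSpace.toDual_symm_apply]
  rfl

theorem continuous_cmGradient (m : Measure H) {u : H → ℝ} (hu : ContDiff ℝ 1 u) :
    Continuous (cmGradient m u) :=
  (InnerProductSpace.toDual ℝ (CameronMartin m)).symm.continuous.comp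
    ((hu.continuous_fderiv one_ne_zero).clm_comp continuous_const)

theorem enorm_sub_le_lintegral_cmGradient (m : Measure H) {u : H → ℝ} (hu : ContDiff ℝ 1 u)
    (z : H) {a : ℝ} (ha : 0 ≤ a) (h : CameronMartin m) :
    ‖u (z + a • CameronMartin.incl m h) - u z‖ₑ ≤ ENNReal.ofReal (a * ‖h‖) *
      ∫⁻ r in Set.Ioc (0 : ℝ) 1, ‖cmGradient m u (z + r • a • CameronMartin.incl m h)‖ₑ := by
  have hgrad := continuous_cmGradient m hu
  have hderiv : ∀ r : ℝ, HasDerivAt (fun r : ℝ => u (z + r • a • CameronMartin.incl m h))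
      (a * inner ℝ (cmGradient m u (z + r • a • CameronMartin.incl m h)) h) r := fun r => by
    have h1 : HasDerivAt (fun r : ℝ => z + r • a • CameronMartin.incl m h)
        (a • CameronMartin.incl m h) r := by
      simpa using ((hasDerivAt_id r).smul_const (a • CameronMartin.incl m h)).const_add z
    have h2 := (hu.differentiable one_ne_zero _).hasFDerivAt.comp_hasDerivAt r h1
    rwa [map_smul, ← inner_cmGradient, smul_eq_mul] at h2
  have hcont : Continuous fun r : ℝ =>
      a * inner ℝ (cmGradient m u (z + r • a • CameronMartin.incl m h)) h := by
    fun_prop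
  have hftc := intervalIntegral.integral_eq_sub_of_hasDerivAt (a := 0) (b := 1)
    (fun r _ => hderiv r) (hcont.intervalIntegrable _ _)
  simp only [one_smul, zero_smul, add_zero] at hftc
  rw [← hftc, intervalIntegral.integral_of_le zero_le_one,
    ← lintegral_const_mul' _ _ ENNReal.ofReal_ne_top]
  refine (enorm_integral_le_lintegral_enorm _).trans (lintegral_mono fun r => ?_)
  rw [← ofReal_norm, ← ofReal_norm,
    ← ENNReal.ofReal_mul (mul_nonneg ha (norm_nonneg _))]
  refine ENNReal.ofReal_le_ofReal ?_
  rw [norm_mul, Real.norm_of_nonneg ha, mul_assoc, mul_comm ‖h‖]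
  exact mul_le_mul_of_nonneg_left (norm_inner_le_norm _ _) ha

/-- The estimate for `C¹` functions: the increment of `u` is integrated along the segment in
direction `h`, and Tonelli's theorem reduces it to means of `|D_𝓗 u|_𝓗` over intermediate
translates. -/
theorem lintegral_enorm_sub_mehlerPoint_le (m : Measure H) [IsGaussian m] (hc : ∫ x, x ∂m = 0)
    (hnondeg : ∀ v : H, covarianceOperator m v = 0 → v = 0) {t : ℝ} (ht : 0 < t) {u : H → ℝ}
    (hu : ContDiff ℝ 1 u) (x : H) (h : CameronMartin m) :
    ∫⁻ y, ‖u (mehlerPoint t (x + CameronMartin.incl m h) y) - u (mehlerPoint t x y)‖ₑ ∂m ≤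
      ENNReal.ofReal (‖h‖ * Real.exp (‖h‖ ^ 2 / (4 * t))) *
        (∫⁻ y, ‖cmGradient m u (mehlerPoint t (x + CameronMartin.incl m h) y)‖ₑ ∂m +
          ∫⁻ y, ‖cmGradient m u (mehlerPoint t x y)‖ₑ ∂m) := by
  have hgrad := continuous_cmGradient m hu
  have hmp : Continuous (mehlerPoint t x) :=
    (continuous_mehlerPoint t).comp (by fun_prop : Continuous fun y : H => (x, y))
  have hexp : Real.exp (-t) ≤ 1 := Real.exp_le_one_iff.2 (by linarith)
  set k := (Real.exp (-t) / √(1 - Real.exp (-2 * t))) • invSqrtCov m h with hk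
  set F : H → ℝ≥0∞ := fun y => ‖cmGradient m u (mehlerPoint t x y)‖ₑ with hF
  have hFm : Measurable F := (hgrad.comp hmp).enorm.measurable
  have hend : ∀ y, mehlerPoint t (x + CameronMartin.incl m h) y =
      mehlerPoint t x y + Real.exp (-t) • CameronMartin.incl m h := fun y => by
    simp only [mehlerPoint, smul_add]
    abel
  have hmid : ∀ (y : H) (r : ℝ),
      mehlerPoint t x y + r • Real.exp (-t) • CameronMartin.incl m h =
        mehlerPoint t x (y + r • sqrtCov m k) := fun y r => by
    rw [hk, smul_comm, ← map_smul (CameronMartin.incl m) r h, ← map_smul (sqrtCov m),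
      smul_comm r, ← map_smul (invSqrtCov m), ← mehlerPoint_add_incl m ht]
    simp only [mehlerPoint, smul_add]
    abel
  have hjoint : Measurable (Function.uncurry fun (y : H) (r : ℝ) => F (y + r • sqrtCov m k)) :=
    hFm.comp (by fun_prop : Continuous fun z : H × ℝ => z.1 + z.2 • sqrtCov m k).measurable
  calc ∫⁻ y, ‖u (mehlerPoint t (x + CameronMartin.incl m h) y) - u (mehlerPoint t x y)‖ₑ ∂m
      ≤ ∫⁻ y, ENNReal.ofReal (Real.exp (-t) * ‖h‖) *
          (∫⁻ r in Set.Ioc (0 : ℝ) 1, F (y + r • sqrtCov m k)) ∂m := by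
        refine lintegral_mono fun y => ?_
        rw [hend]
        refine (enorm_sub_le_lintegral_cmGradient m hu _ (Real.exp_nonneg _) h).trans_eq ?_
        simp_rw [hmid, hF]
    _ = ENNReal.ofReal (Real.exp (-t) * ‖h‖) *
          ∫⁻ r in Set.Ioc (0 : ℝ) 1, ∫⁻ y, F (y + r • sqrtCov m k) ∂m := by
        rw [lintegral_const_mul' _ _ ENNReal.ofReal_ne_top,
          lintegral_lintegral_swap hjoint.aemeasurable]
    _ ≤ ENNReal.ofReal (Real.exp (-t) * ‖h‖) *
          (ENNReal.ofReal (Real.exp (‖k‖ ^ 2 / 2)) *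
            (∫⁻ y, F (y + sqrtCov m k) ∂m + ∫⁻ y, F y ∂m)) := by
        gcongr
        refine (setLIntegral_mono' measurableSet_Ioc fun r hr =>
          lintegral_add_smul_le m hc hnondeg k hr.1.le hr.2 hFm).trans_eq ?_
        simp
    _ ≤ _ := by
        simp_rw [mehlerPoint_add_incl m ht, ← hk]
        rw [← mul_assoc, ← ENNReal.ofReal_mul (mul_nonneg (Real.exp_nonneg _) (norm_nonneg _))]
        gcongr ENNReal.ofReal (?_ * ?_) * _
        · exact mul_le_of_le_one_left (norm_nonneg _) hexp
        · exact Real.exp_le_exp.2 (norm_sq_smul_invSqrtCov_le m ht h)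

/-! ### Passage to the limit -/

theorem integrable_mehlerPoint_add_incl (m : Measure H) [IsGaussian m] (hc : ∫ x, x ∂m = 0)
    (hnondeg : ∀ v : H, covarianceOperator m v = 0 → v = 0) {p : ℝ≥0∞} (hp : 1 < p) {t : ℝ}
    (ht : 0 < t) {F : H → ℝ} (hF : Measurable F) {x : H}
    (hFp : MemLp (fun y => F (mehlerPoint t x y)) p m) (h : CameronMartin m) :
    Integrable (fun y => F (mehlerPoint t (x + CameronMartin.incl m h) y)) m := by
  obtain ⟨C, hC, hle⟩ := exists_eLpNorm_add_right_le m hc hnondeg hp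
    ((Real.exp (-t) / √(1 - Real.exp (-2 * t))) • invSqrtCov m h)
  rw [← memLp_one_iff_integrable]
  refine ⟨(hF.comp (measurable_mehlerPoint_right t _)).aestronglyMeasurable, ?_⟩
  simp_rw [mehlerPoint_add_incl m ht]
  exact (hle _ (hF.comp (measurable_mehlerPoint_right t x))).trans_lt
    (ENNReal.mul_lt_top hC.lt_top hFp.eLpNorm_lt_top)

/-- Convergence in `L^p(m)` of the sections at the base point `x` implies convergence of Mehler's
integrals at every point of `x + 𝓗`. -/
theorem tendsto_mehler_add_incl (m : Measure H) [IsGaussian m] (hc : ∫ x, x ∂m = 0)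
    (hnondeg : ∀ v : H, covarianceOperator m v = 0 → v = 0) {p : ℝ≥0∞} (hp : 1 < p) {t : ℝ}
    (ht : 0 < t) {F : ℕ → H → ℝ} {f : H → ℝ} (hF : ∀ n, Measurable (F n)) (hf : Measurable f)
    {x : H} (hFp : ∀ n, MemLp (fun y => F n (mehlerPoint t x y)) p m)
    (hlim : Tendsto (fun n => eLpNorm
      (fun y => F n (mehlerPoint t x y) - f (mehlerPoint t x y)) p m) atTop (𝓝 0))
    (h : CameronMartin m) :
    Tendsto (fun n => mehler m t (F n) (x + CameronMartin.incl m h)) atTop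
      (𝓝 (mehler m t f (x + CameronMartin.incl m h))) := by
  obtain ⟨C, hC, hle⟩ := exists_eLpNorm_add_right_le m hc hnondeg hp
    ((Real.exp (-t) / √(1 - Real.exp (-2 * t))) • invSqrtCov m h)
  refine tendsto_integral_of_L1' _
    (hf.comp (measurable_mehlerPoint_right t _)).aestronglyMeasurable
    (Eventually.of_forall fun n =>
      integrable_mehlerPoint_add_incl m hc hnondeg hp ht (hF n) (hFp n) h) ?_
  have h0 : Tendsto (fun n => C * eLpNorm
      (fun y => F n (mehlerPoint t x y) - f (mehlerPoint t x y)) p m) atTop (𝓝 0) := by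
    simpa using ENNReal.Tendsto.const_mul hlim (Or.inr hC)
  refine tendsto_of_tendsto_of_tendsto_of_le_of_le tendsto_const_nhds h0
    (fun _ => zero_le) fun n => ?_
  have h1 := hle (fun y => F n (mehlerPoint t x y) - f (mehlerPoint t x y))
    (((hF n).comp (measurable_mehlerPoint_right t x)).sub
      (hf.comp (measurable_mehlerPoint_right t x)))
  simp only [← mehlerPoint_add_incl m ht] at h1
  exact h1

/-- The estimate for `C¹` functions, between Mehler integrals that converge absolutely. -/
theorem abs_mehler_sub_le (m : Measure H) [IsGaussian m] (hc : ∫ x, x ∂m = 0)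
    (hnondeg : ∀ v : H, covarianceOperator m v = 0 → v = 0) {p : ℝ≥0∞} (hp : 1 < p) {t : ℝ}
    (ht : 0 < t) {u : H → ℝ} (hu : ContDiff ℝ 1 u) {x : H}
    (hup : MemLp (fun y => u (mehlerPoint t x y)) p m)
    (hgp : MemLp (fun y => ‖cmGradient m u (mehlerPoint t x y)‖) p m) (h : CameronMartin m) :
    |mehler m t u (x + CameronMartin.incl m h) - mehler m t u x| ≤
      ‖h‖ * Real.exp (‖h‖ ^ 2 / (4 * t)) *
        (mehler m t (fun z => ‖cmGradient m u z‖) (x + CameronMartin.incl m h) +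
          mehler m t (fun z => ‖cmGradient m u z‖) x) := by
  have hum := hu.continuous.measurable
  have hgm := (continuous_cmGradient m hu).norm.measurable
  have hu1 := integrable_mehlerPoint_add_incl m hc hnondeg hp ht hum hup h
  have hg1 := integrable_mehlerPoint_add_incl m hc hnondeg hp ht hgm hgp h
  have hu0 := hup.integrable hp.le
  have hg0 := hgp.integrable hp.le
  have hnonneg : ∀ x, 0 ≤ mehler m t (fun z => ‖cmGradient m u z‖) x := fun x =>
    integral_nonneg fun y => norm_nonneg _
  have e : ∀ x, Integrable (fun y => ‖cmGradient m u (mehlerPoint t x y)‖) m →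
      ∫⁻ y, ‖cmGradient m u (mehlerPoint t x y)‖ₑ ∂m =
        ENNReal.ofReal (mehler m t (fun z => ‖cmGradient m u z‖) x) := fun x hx => by
    rw [mehler, ofReal_integral_eq_lintegral_ofReal hx (ae_of_all _ fun _ => norm_nonneg _)]
    simp_rw [ofReal_norm]
  have hmain := (enorm_integral_le_lintegral_enorm _).trans
    (lintegral_enorm_sub_mehlerPoint_le m hc hnondeg ht hu x h)
  have hC : 0 ≤ ‖h‖ * Real.exp (‖h‖ ^ 2 / (4 * t)) := by positivity
  rw [integral_sub hu1 hu0, e _ hg1, e _ hg0, ← ENNReal.ofReal_add (hnonneg _) (hnonneg _),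
    ← ENNReal.ofReal_mul hC, ← ofReal_norm,
    ENNReal.ofReal_le_ofReal_iff (mul_nonneg hC (add_nonneg (hnonneg _) (hnonneg _)))] at hmain
  exact hmain

end

end WienerSpace

theorem mainTheorem8 {H : Type*} [NormedAddCommGroup H] [InnerProductSpace ℝ H] [CompleteSpace H]
    [SecondCountableTopology H] [MeasurableSpace H] [BorelSpace H]
    (m : Measure H) [IsGaussian m]
    (hcentered : ∫ x, x ∂m = 0)
    (hnondeg : ∀ v : H, covarianceOperator m v = 0 → v = 0)
    (p : ℝ≥0∞) (hp : 1 < p) (hp' : p ≠ ⊤) (t : ℝ) (ht : 0 < t)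
    (f : H → ℝ) (hf : Measurable f)
    (G : H → WienerSpace.CameronMartin m) (hG : WienerSpace.HasSobolevGradient m p f G)
    (g : H → ℝ) (hg : Measurable g) (hgG : ∀ᵐ x ∂m, g x = ‖G x‖) :
    ∀ᵐ x₀ ∂m, ∀ h : WienerSpace.CameronMartin m,
      Integrable (fun y => f (WienerSpace.mehlerPoint t (x₀ + WienerSpace.CameronMartin.incl m h) y)) m ∧
      Integrable (fun y => g (WienerSpace.mehlerPoint t (x₀ + WienerSpace.CameronMartin.incl m h) y)) m ∧
      |WienerSpace.mehler m t f (x₀ + WienerSpace.CameronMartin.incl m h)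
          - WienerSpace.mehler m t f x₀|
        ≤ ‖h‖ * Real.exp (‖h‖ ^ 2 / (4 * t)) *
          (WienerSpace.mehler m t g (x₀ + WienerSpace.CameronMartin.incl m h)
            + WienerSpace.mehler m t g x₀) := by
  obtain ⟨hfp, hGp, u, hu, hlimf, hlimG⟩ := hG
  have hp0 : p ≠ 0 := (zero_lt_one.trans hp).ne'
  have hpos : 0 < p.toReal := ENNReal.toReal_pos hp0 hp'
  have huC := fun n => (hu n).1.contDiff
  have hum := fun n => (huC n).continuous.measurable
  have hgm := fun n => (WienerSpace.continuous_cmGradient m (huC n)).norm.measurable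
  have hgp : MemLp g p m := hGp.norm.ae_eq (hgG.mono fun x hx => hx.symm)
  have hlimg : Tendsto (fun n => eLpNorm
      (fun x => ‖WienerSpace.cmGradient m (u n) x‖ - g x) p m) atTop (𝓝 0) := by
    refine tendsto_of_tendsto_of_tendsto_of_le_of_le tendsto_const_nhds hlimG
      (fun _ => zero_le) fun n => eLpNorm_mono_ae ?_
    filter_upwards [hgG] with x hx
    rw [hx, Real.norm_eq_abs]
    exact abs_norm_sub_norm_le _ _
  -- along a fast subsequence the sections at almost every base point converge in `L^p(m)`
  obtain ⟨φ, -, hsum⟩ := WienerSpace.exists_strictMono_tsum_ne_top (a := fun n =>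
      eLpNorm (fun x => u n x - f x) p m ^ p.toReal +
        eLpNorm (fun x => ‖WienerSpace.cmGradient m (u n) x‖ - g x) p m ^ p.toReal) (by
    simpa [ENNReal.zero_rpow_of_pos hpos] using
      (hlimf.ennrpow_const p.toReal).add (hlimg.ennrpow_const p.toReal))
  rw [ENNReal.tsum_add, ENNReal.add_ne_top] at hsum
  filter_upwards [WienerSpace.ae_memLp_mehlerPoint m hcentered ht.le hp0 hp' hf hfp,
    WienerSpace.ae_memLp_mehlerPoint m hcentered ht.le hp0 hp' hg hgp,
    ae_all_iff.2 fun n =>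
      WienerSpace.ae_memLp_mehlerPoint m hcentered ht.le hp0 hp' (hum n) (hu n).2.1,
    ae_all_iff.2 fun n =>
      WienerSpace.ae_memLp_mehlerPoint m hcentered ht.le hp0 hp' (hgm n) (hu n).2.2.norm,
    WienerSpace.ae_tendsto_eLpNorm_mehlerPoint m hcentered ht.le hp0 hp'
      (fun n => (hum (φ n)).sub hf) hsum.1,
    WienerSpace.ae_tendsto_eLpNorm_mehlerPoint m hcentered ht.le hp0 hp'
      (fun n => (hgm (φ n)).sub hg) hsum.2] with x hfx hgx hux hDx hlimfx hlimgx h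
  refine ⟨WienerSpace.integrable_mehlerPoint_add_incl m hcentered hnondeg hp ht hf hfx h,
    WienerSpace.integrable_mehlerPoint_add_incl m hcentered hnondeg hp ht hg hgx h, ?_⟩
  have hT := WienerSpace.tendsto_mehler_add_incl m hcentered hnondeg hp ht
    (fun n => hum (φ n)) hf (fun n => hux (φ n)) hlimfx
  have hD := WienerSpace.tendsto_mehler_add_incl m hcentered hnondeg hp ht
    (fun n => hgm (φ n)) hg (fun n => hDx (φ n)) hlimgx
  -- `h = 0` gives the convergence at the base point itself
  have hT0 := hT 0
  have hD0 := hD 0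
  rw [map_zero, add_zero] at hT0 hD0
  exact le_of_tendsto_of_tendsto' ((hT h).sub hT0).abs (((hD h).add hD0).const_mul _) fun n =>
    WienerSpace.abs_mehler_sub_le m hcentered hnondeg hp ht (huC (φ n)) (hux (φ n)) (hDx (φ n)) h
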